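/- **Setting.** Let $\mathcal G=(\mathcal V,\mathcal E)$ be a finite directed graph with two distinct vertices $v_{\rm source}$, $v_{\rm target}$ and a lazy estimate $\hat w:\mathcal E\to[0,\infty)$. Some edges are in collision; the true cost of an edge is $w(e)=\hat w(e)$ if $e$ is not in collision and $w(e)=\infty$ otherwise, and the cost $w(P)$ of a path is the sum of the costs of its edges. Let $w^*(v)$ be the minimal cost $w(P)$ of a path $P$ from $v_{\rm source}$ to $v$ ($\infty$ if there is no collision-free one). **The algorithm LRA\* with lookahead $\alpha\in\{1,2,\dots\}\cup\{\infty\}$.** It maintains a tree $\mathcal T$ with at most one node $\tau_v=(v,p,c,\ell,b)$ per vertex $v$; $p$ is the parent, $P[\tau]$ is the path from $v_{\rm source}$ to the vertex of $\tau$ obtained by backtracking parents, $b[\tau]$ is the number of its last edges that are not evaluated (these form $P[\tau]_{\rm tail}$), $c[\tau]$ is the cost of the evaluated part, $\ell[\tau]$ the lazy cost of the tail, and $c[\tau]+\ell[\tau]$ is the key of $\tau$. Call a node of $\mathcal T$ *extensible* if its budget $b$ is less than $\alpha$ and its vertex is not $v_{\rm target}$. Initially $\mathcal T$ consists of $\tau_{v_{\rm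 source}}=(v_{\rm source},\text{NIL},0,0,0)$. 1. *Extend.* As long as there are an extensible node $\tau_p$ and an edge $(p,x)$ of the current graph such that $x$ has no node in $\mathcal T$, or $c[\tau_p]+\ell[\tau_p]+\hat w(p,x)$ is less than the key of $\tau_x$: remove $\tau_x$ and its descendants from $\mathcal T$ (if $\tau_x$ is in $\mathcal T$), and insert $\tau_x=(x,p,c[\tau_p],\ell[\tau_p]+\hat w(p,x),b[\tau_p]+1)$. 2. *Search.* If no node has budget $\alpha$ and $\tau_{v_{\rm target}}\notin\mathcal T$, return failure. Otherwise choose $\tau$ of minimal key among the nodes of budget $\alpha$ and $\tau_{v_{\rm target}}$ (if it is in $\mathcal T$), and evaluate the first edge $(u,v)$ of $P[\tau]_{\rm tail}$. 3. *If $(u,v)$ is collision-free*, set $\tau_v=(v,u,c[\tau_u]+w(u,v),0,0)$. If $v=v_{\rm target}$, return $P[\tau_{v_{\rm target}}]$. Otherwise recompute, parents before children, the entries of the descendants of $\tau_v$: a child $x$ of $q$ gets $(x,q,c[\tau_q],\ell[\tau_q]+\hat w(q,x),b[\tau_q]+1)$. Go to 1. 4. *If $(u,v)$ is in collision*, remove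 it from the graph, take $\tau_v$ and its descendants out of $\mathcal T$, and rewire them: repeatedly, among the removed nodes $\tau_x$ and the edges $(p,x)$ of the current graph with $\tau_p\in\mathcal T$ extensible, choose a pair with the least value of $c[\tau_p]+\ell[\tau_p]+\hat w(p,x)$ and insert $\tau_x$ as a child of $\tau_p$ with entries as in step 1, until there is no such pair. Go to 1. All choices that are left open (the order of the operations in steps 1 and 3, ties between keys) may be made arbitrarily. **Statement.** For every lookahead $\alpha\ge 1$ and every way of making the choices: (a) If LRA\* evaluates an edge $(v_0,v)$ and finds it collision-free, then from that moment (after the update of $\tau_v$ in step 3) on, $\tau_v$ has parent $v_0$, lazy cost $\ell=0$ and budget $b=0$, the path $P[\tau_v]$ is a shortest collision-free path from $v_{\rm source}$ to $v$, and $c[\tau_v]=w(P[\tau_v])=w^*(v)$. (b) LRA\* is complete: it terminates after finitely many steps, by returning a path or failure. If it returns a path, this is a shortest collision-free path from $v_{\rm source}$ to $v_{\rm target}$, of cost $w^*(v_{\rm target})$; it returns failure only if there is no collision-free path from $v_{\rm source}$ to $v_{\rm target}$. Hence, whenever a collision-free path exists, LRA\* returns a shortest one. -/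

import Mathlib

open scoped ENNReal NNReal

noncomputable section

namespace LRAStar

/-- A lazy shortest-path problem on a directed graph with vertex set `V`: the edges, the lazy
estimate `wHat` of the edge costs, the edges that are in collision, the source and the target. -/
structure Problem (V : Type*) where
  edges : Set (V × V)
  wHat : V × V → ℝ≥0
  collision : Set (V × V)
  source : V
  target : V

variable {V : Type*}

namespace Problem

open Classical in
/-- The true cost of an edge: the lazy estimate if the edge is not in collision, `∞` if it is. -/
def w (G : Problem V) (e : V × V) : ℝ≥0∞ :=
  if e ∈ G.collision then ⊤ else (G.wHat e : ℝ≥0∞)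

/-- `P` is the sequence of vertices of a path of the graph from the source to `v`. -/
def IsPathTo (G : Problem V) (v : V) (P : List V) : Prop :=
  P.head? = some G.source ∧ P.getLast? = some v ∧ P.IsChain (fun a b => (a, b) ∈ G.edges)

/-- The true cost of a path: the sum of the true costs of its edges. -/
def cost (G : Problem V) (P : List V) : ℝ≥0∞ :=
  ((P.zip P.tail).map G.w).sum

/-- A path is collision-free if none of its edges is in collision. -/
def CollisionFree (G : Problem V) (P : List V) : Prop :=
  ∀ e ∈ P.zip P.tail, e ∉ G.collision

/-- `w*(v)`, the minimal true cost-to-come of `v` (`∞` if no collision-free path reaches `v`). -/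
def wStar (G : Problem V) (v : V) : ℝ≥0∞ :=
  ⨅ (P : List V) (_ : G.IsPathTo v P), G.cost P

/-- `P` is a shortest collision-free path from the source to `v`. -/
def IsShortestFreePath (G : Problem V) (v : V) (P : List V) : Prop :=
  G.IsPathTo v P ∧ G.CollisionFree P ∧
    ∀ Q, G.IsPathTo v Q → G.CollisionFree Q → G.cost P ≤ G.cost Q

end Problem

/-- The entry `(p, c, ℓ, b)` of a node of the search tree: the parent (`none` is NIL), the cost of
the evaluated part of the path, the lazy cost of the part that is not evaluated, and the budget. -/
structure Entry (V : Type*) where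
  parent : Option V
  c : ℝ≥0
  l : ℝ≥0
  b : ℕ

/-- The estimated cost-to-come `c + ℓ`, by which nodes are ordered. -/
def Entry.key (e : Entry V) : ℝ≥0 := e.c + e.l

/-- The entry of the node of `x` when its parent is `p`, which has the entry `e`, and the edge
`(p, x)` is not evaluated. -/
def Entry.child (G : Problem V) (p : V) (e : Entry V) (x : V) : Entry V :=
  ⟨some p, e.c, e.l + G.wHat (p, x), e.b + 1⟩

/-- The data of the algorithm: the edges not yet removed from the graph, and the search tree `T`.
Every vertex has at most one node; `node v = none` means that `v` has no node in `T`. -/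
structure State (V : Type*) where
  edges : Set (V × V)
  node : V → Option (Entry V)

namespace State

/-- `p` is the parent of `x` in the search tree. -/
def IsParent (S : State V) (p x : V) : Prop :=
  ∃ e, S.node x = some e ∧ e.parent = some p

/-- `v` and its descendants in the search tree. -/
def subtree (S : State V) (v : V) : Set V :=
  {x | Relation.ReflTransGen S.IsParent v x}

/-- `S.TreePath x P` says that `P` is the path `P[τ]` obtained by backtracking the parents from
the node `τ` of `x` to the root. -/
inductive TreePath (S : State V) : V → List V → Prop
  | root {x : V} {e : Entry V} (hx : S.node x = some e) (hp : e.parent = none) : TreePath S x [x]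
  | step {x p : V} {e : Entry V} {P : List V} (hx : S.node x = some e) (hp : e.parent = some p)
      (hP : TreePath S p P) : TreePath S x (P ++ [x])

open Classical in
/-- Set the entry of the node of `v`, inserting it if it is not in the tree. -/
def setNode (S : State V) (v : V) (e : Entry V) : State V :=
  ⟨S.edges, fun x => if x = v then some e else S.node x⟩

open Classical in
/-- Remove from the tree the nodes of the vertices in `R`. -/
def removeNodes (S : State V) (R : Set V) : State V :=
  ⟨S.edges, fun x => if x ∈ R then none else S.node x⟩

/-- Remove an edge from the graph. -/
def removeEdge (S : State V) (e : V × V) : State V :=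
  ⟨S.edges \ {e}, S.node⟩

open Classical in
/-- Recompute the entries of the children of `q` from the entry `e` of `q`. -/
def updateChildren (G : Problem V) (S : State V) (q : V) (e : Entry V) : State V :=
  ⟨S.edges, fun x => if S.IsParent q x then some (Entry.child G q e x) else S.node x⟩

/-- The nodes in the frontier queue: those of budget `α`, and the one of the target (which is
never extended, so that it need not reach the budget `α`). -/
def InFrontier (G : Problem V) (α : ℕ∞) (S : State V) (x : V) (e : Entry V) : Prop :=
  S.node x = some e ∧ ((e.b : ℕ∞) = α ∨ x = G.target)

/-- The node of `p`, with entry `e`, can serve as a parent of `x` in the `α`-band. -/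
def CanParent (G : Problem V) (α : ℕ∞) (S : State V) (p : V) (e : Entry V) (x : V) : Prop :=
  S.node p = some e ∧ (e.b : ℕ∞) < α ∧ p ≠ G.target ∧ (p, x) ∈ S.edges

/-- The node of `p` can be extended along the edge `(p, x)`: either `x` has no node in the tree,
or the way through `p` is cheaper than the one that is stored. -/
def Extends (G : Problem V) (α : ℕ∞) (S : State V) (p : V) (e : Entry V) (x : V) : Prop :=
  S.CanParent G α p e x ∧ ∀ e', S.node x = some e' → (Entry.child G p e x).key < e'.key

/-- `(u, v)` is the first edge along `P[τ]_tail` for a node `τ` of minimal key in the frontier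
queue; `P[τ]_tail` consists of the last `b[τ]` edges of `P[τ]`. -/
def Selects (G : Problem V) (α : ℕ∞) (S : State V) (u v : V) : Prop :=
  ∃ x e, S.InFrontier G α x e ∧ (∀ x' e', S.InFrontier G α x' e' → e.key ≤ e'.key) ∧
    ∃ pre rest, S.TreePath x (pre ++ u :: v :: rest) ∧ (v :: rest).length = e.b

/-- The initial data: the whole graph, and a tree that consists of the node of the source. -/
def init (G : Problem V) : State V :=
  State.setNode ⟨G.edges, fun _ => none⟩ G.source ⟨none, 0, 0, 0⟩

end State

/-- A configuration of the algorithm: where the execution stands, with the data at that point. -/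
inductive Config (V : Type*)
  /-- extending the `α`-band -/
  | extend (S : State V)
  /-- the head of the main loop -/
  | search (S : State V)
  /-- the edge `(u, v)` was evaluated and found collision-free, and the node of `v` was updated -/
  | foundFree (u v : V) (S : State V)
  /-- updating descendants; `Q` holds the nodes whose children have still to be updated -/
  | update (Q : Set V) (S : State V)
  /-- rewiring after a collision; `R` holds the nodes, taken out of the tree, still to be rewired -/
  | rewire (R : Set V) (S : State V)
  /-- the algorithm has stopped and returned the path `P` -/
  | returned (P : List V)
  /-- the algorithm has stopped and returned failure -/
  | failure

/-- The data of a configuration, as long as the algorithm has not stopped. -/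
def Config.state? : Config V → Option (State V)
  | .extend S => some S
  | .search S => some S
  | .foundFree _ _ S => some S
  | .update _ S => some S
  | .rewire _ S => some S
  | .returned _ => none
  | .failure => none

/-- One step of `LRA*` with lookahead `α`. All choices (the order in which nodes are extended or
updated, and the choice among nodes of equal key) are left open. -/
inductive Step (G : Problem V) (α : ℕ∞) : Config V → Config V → Prop
  /-- Extend the node of `p` along the edge `(p, x)`. If `x` already has a node, that node and its
  descendants are removed from the tree before the node of `x` is inserted as a child of `p`. -/
  | extendNode {S : State V} {p x : V} {e : Entry V} (h : S.Extends G α p e x) :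
      Step G α (.extend S)
        (.extend ((S.removeNodes (S.subtree x)).setNode x (Entry.child G p e x)))
  /-- The extension ends when no node can be extended. -/
  | extendDone {S : State V} (h : ∀ p e x, ¬ S.Extends G α p e x) :
      Step G α (.extend S) (.search S)
  /-- The frontier queue is empty. -/
  | fail {S : State V} (h : ∀ x e, ¬ S.InFrontier G α x e) :
      Step G α (.search S) .failure
  /-- The selected edge is evaluated and found collision-free; the node of `v` is updated. -/
  | evalFree {S : State V} {u v : V} {e : Entry V} (h : S.Selects G α u v)
      (hu : S.node u = some e) (hw : G.w (u, v) = (G.wHat (u, v) : ℝ≥0∞)) :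
      Step G α (.search S) (.foundFree u v (S.setNode v ⟨some u, e.c + G.wHat (u, v), 0, 0⟩))
  /-- The selected edge is evaluated and found in collision; it is removed from the graph, and the
  node of `v` and its descendants are taken out of the tree for rewiring. -/
  | evalCollision {S : State V} {u v : V} (h : S.Selects G α u v)
      (hw : G.w (u, v) ≠ (G.wHat (u, v) : ℝ≥0∞)) :
      Step G α (.search S)
        (.rewire (S.subtree v) ((S.removeEdge (u, v)).removeNodes (S.subtree v)))
  /-- The edge found collision-free leads to the target: return `P[τ_target]`. -/
  | ret {S : State V} {u v : V} {P : List V} (hv : v = G.target) (hP : S.TreePath v P) :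
      Step G α (.foundFree u v S) (.returned P)
  /-- Otherwise start to update the descendants of the node of `v`. -/
  | startUpdate {S : State V} {u v : V} (hv : v ≠ G.target) :
      Step G α (.foundFree u v S) (.update {v} S)
  /-- Take a node from the queue, update its children, and put these into the queue. -/
  | updateNode {S : State V} {Q : Set V} {q : V} {e : Entry V} (hq : q ∈ Q)
      (he : S.node q = some e) :
      Step G α (.update Q S)
        (.update ((Q \ {q}) ∪ {x | S.IsParent q x}) (S.updateChildren G q e))
  /-- The update ends when the queue is empty. -/
  | updateDone {S : State V} : Step G α (.update ∅ S) (.extend S)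
  /-- Rewire to its best parent in the tree the node, among those to be rewired, for which the
  resulting key is minimal. -/
  | rewireNode {S : State V} {R : Set V} {p x : V} {e : Entry V} (hx : x ∈ R)
      (h : S.CanParent G α p e x)
      (hmin : ∀ x' ∈ R, ∀ p' e', S.CanParent G α p' e' x' →
        (Entry.child G p e x).key ≤ (Entry.child G p' e' x').key) :
      Step G α (.rewire R S) (.rewire (R \ {x}) (S.setNode x (Entry.child G p e x)))
  /-- The rewiring ends when no node that is left has a possible parent; the nodes that are left
  stay out of the tree. -/
  | rewireDone {S : State V} {R : Set V} (h : ∀ x ∈ R, ∀ p e, ¬ S.CanParent G α p e x) :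
      Step G α (.rewire R S) (.extend S)

/-- `c'` can be reached from `c` in finitely many steps. -/
def Reaches (G : Problem V) (α : ℕ∞) : Config V → Config V → Prop :=
  Relation.ReflTransGen (Step G α)

/-- The configuration in which the algorithm starts: it extends the `α`-band from the source. -/
def start (G : Problem V) : Config V := .extend (State.init G)

end LRAStar

end

namespace LRAStar

variable {V : Type*} {G : Problem V} {α : ℕ∞} {S S' : State V} {Q : Set V}

/-! Call a node settled if its budget is zero. As in Dijkstra's algorithm, the key of a settled node
is at most the lazy cost of every walk to its vertex in the current graph (`Inv.opt`). Only edges in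
collision are ever deleted, so these walks include all collision-free paths. The tree path of a
settled node is itself collision-free with cost equal to the key, hence shortest
(`isShortestFreePath`).

An edge (u, v) is evaluated only when no extension is left. Every walk to v then costs at least the
key of v or the key of some frontier node (`covered`). The selected node has minimal key in the
frontier and lies in the subtree of v, and keys do not decrease down the tree; so the key of v is
the lazy distance (`selects_spec`). The same covering argument shows that an empty frontier rules
out a collision-free path to the target. Settled nodes are permanent: no lazy walk undercuts them,
and since budgets do not decrease down the tree, no removed subtree contains one
(`ConfigInv.keepsSettled`).

For termination, each evaluation settles a vertex or deletes an edge. In between, updating moves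
down the tree, rewiring consumes a finite set, and each extension increases a bounded weight of the
tree (`treeWeight_lt_extendBy`), because all keys are lazy costs of vertex sequences without
repetition. `rank` combines these measures lexicographically. -/

/-- `LazyReach G E v k`: the edges `E` contain a walk from the source to `v` of lazy cost `k`. -/
inductive LazyReach (G : Problem V) (E : Set (V × V)) : V → ℝ≥0 → Prop
  | source : LazyReach G E G.source 0
  | step {p x : V} {k : ℝ≥0} (hp : LazyReach G E p k) (hx : (p, x) ∈ E) :
      LazyReach G E x (k + G.wHat (p, x))

theorem LazyReach.mono {E F : Set (V × V)} (hEF : E ⊆ F) {v : V} {k : ℝ≥0}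
    (h : LazyReach G E v k) : LazyReach G F v k := by
  induction h with
  | source => exact .source
  | step _ hx ih => exact .step ih (hEF hx)

@[simp] theorem Entry.child_key (p : V) (e : Entry V) (x : V) :
    (Entry.child G p e x).key = e.key + G.wHat (p, x) := by
  simp [Entry.key, Entry.child, add_assoc]

@[simp] theorem Entry.child_b (p : V) (e : Entry V) (x : V) :
    (Entry.child G p e x).b = e.b + 1 := rfl

@[simp] theorem Entry.child_parent (p : V) (e : Entry V) (x : V) :
    (Entry.child G p e x).parent = some p := rfl

/-! ### Elementary operations on the search tree -/

namespace State

theorem setNode_self (S : State V) (v : V) (e : Entry V) : (S.setNode v e).node v = some e := by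
  simp [setNode]

theorem setNode_of_ne (S : State V) {v x : V} (e : Entry V) (h : x ≠ v) :
    (S.setNode v e).node x = S.node x := by
  simp [setNode, h]

theorem removeNodes_of_mem (S : State V) {R : Set V} {x : V} (h : x ∈ R) :
    (S.removeNodes R).node x = none := by
  simp [removeNodes, h]

theorem removeNodes_of_notMem (S : State V) {R : Set V} {x : V} (h : x ∉ R) :
    (S.removeNodes R).node x = S.node x := by
  simp [removeNodes, h]

theorem removeNodes_eq_some {R : Set V} {x : V} {e : Entry V} :
    (S.removeNodes R).node x = some e ↔ x ∉ R ∧ S.node x = some e := by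
  by_cases h : x ∈ R <;> simp [removeNodes, h]

theorem updateChildren_of_isParent {q x : V} (e : Entry V) (h : S.IsParent q x) :
    (S.updateChildren G q e).node x = some (Entry.child G q e x) := by
  simp [updateChildren, h]

theorem updateChildren_of_not_isParent {q x : V} (e : Entry V) (h : ¬ S.IsParent q x) :
    (S.updateChildren G q e).node x = S.node x := by
  simp [updateChildren, h]

theorem IsParent.eq {p p' x : V} (h : S.IsParent p x) (h' : S.IsParent p' x) : p = p' := by
  obtain ⟨e, he, hp⟩ := h
  obtain ⟨e', he', hp'⟩ := h'
  simp_all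

theorem mem_subtree_self (S : State V) (v : V) : v ∈ S.subtree v := Relation.ReflTransGen.refl

theorem subtree_closed {v p x : V} (hp : p ∈ S.subtree v) (h : S.IsParent p x) :
    x ∈ S.subtree v := Relation.ReflTransGen.tail hp h

/-! ### The invariant of the search tree -/

/-- `p` lies in the subtree of a vertex of `Q`. -/
def Pending (S : State V) (Q : Set V) (p : V) : Prop := ∃ q ∈ Q, p ∈ S.subtree q

@[simp] theorem not_pending_empty (p : V) : ¬ S.Pending ∅ p := by simp [Pending]

theorem Pending.congr {S' : State V} (h : S'.IsParent = S.IsParent) :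
    S'.Pending = S.Pending := by
  funext Q p
  simp [Pending, subtree, h]

/-- The entries `f` of `p` and `e` of its child `x` fit together: either `(p, x)` is not evaluated,
or it is evaluated and free; below `Q`, where `e` may be out of date, only the key is exact. -/
def Fits (G : Problem V) (S : State V) (Q : Set V) (p x : V) (f e : Entry V) : Prop :=
  e = Entry.child G p f x ∨
  (¬ S.Pending Q p ∧ f.b = 0 ∧ (p, x) ∉ G.collision ∧
    e = ⟨some p, f.c + G.wHat (p, x), 0, 0⟩) ∨
  (S.Pending Q p ∧ f.key + G.wHat (p, x) = e.key ∧ f.b + 1 ≤ e.b)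

/-- The invariant of the search tree; the entries strictly below `Q` may be out of date. -/
structure Inv (G : Problem V) (α : ℕ∞) (S : State V) (Q : Set V) : Prop where
  edges_sub : S.edges ⊆ G.edges
  free_mem : ∀ e ∈ G.edges, e ∉ G.collision → e ∈ S.edges
  source : S.node G.source = some ⟨none, 0, 0, 0⟩
  fits : ∀ x e, S.node x = some e → x ≠ G.source →
    ∃ p f, e.parent = some p ∧ S.node p = some f ∧ (p, x) ∈ S.edges ∧ S.Fits G Q p x f e
  acyclic : ∃ d : V → ℕ, ∀ p x, S.IsParent p x → d p < d x
  opt : ∀ x e, S.node x = some e → e.b = 0 → ∀ k, LazyReach G S.edges x k → e.key ≤ k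
  budget : ∀ x e, S.node x = some e → (e.b : ℕ∞) ≤ α

namespace Inv

theorem source_not_child (h : Inv G α S Q) (p : V) : ¬ S.IsParent p G.source := by
  rintro ⟨e, he, hp⟩
  rw [h.source] at he
  cases he
  simp at hp

theorem ne_source (h : Inv G α S Q) {p x : V} (hx : S.IsParent p x) : x ≠ G.source := by
  rintro rfl
  exact h.source_not_child p hx

theorem fits_of_parent (h : Inv G α S Q) {p x : V} {e : Entry V} (hx : S.node x = some e)
    (hp : e.parent = some p) :
    ∃ f, S.node p = some f ∧ (p, x) ∈ S.edges ∧ S.Fits G Q p x f e := by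
  obtain ⟨p', f, hp', hf, hE, hF⟩ := h.fits x e hx (h.ne_source ⟨e, hx, hp⟩)
  obtain rfl : p = p' := by simpa [hp] using hp'
  exact ⟨f, hf, hE, hF⟩

theorem eq_source (h : Inv G α S Q) {x : V} {e : Entry V} (hx : S.node x = some e)
    (hp : e.parent = none) : x = G.source := by
  by_contra hne
  obtain ⟨p, f, hp', -⟩ := h.fits x e hx hne
  simp [hp] at hp'

/-- The out-of-date alternative of `Fits` forces a positive budget, so budget zero leaves only the
source and evaluated children. -/
theorem lazy_eq_zero (h : Inv G α S Q) {x : V} {e : Entry V} (hx : S.node x = some e)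
    (hb : e.b = 0) : e.l = 0 := by
  by_cases hs : x = G.source
  · subst hs
    rw [h.source] at hx
    cases hx
    rfl
  · obtain ⟨p, f, -, -, -, rfl | ⟨-, -, -, rfl⟩ | ⟨-, -, hb'⟩⟩ := h.fits x e hx hs
    · simp at hb
    · rfl
    · omega

/-- Evaluation moves cost from ℓ to c and preserves the sum. Keys are therefore exact even below
`Q`, where the split and the budget may be stale. -/
theorem key_eq (h : Inv G α S Q) {p x : V} {f e : Entry V} (hp : S.node p = some f)
    (hF : S.Fits G Q p x f e) : e.key = f.key + G.wHat (p, x) := by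
  obtain rfl | ⟨-, hb, -, rfl⟩ | ⟨-, hk, -⟩ := hF
  · simp
  · simp [Entry.key, h.lazy_eq_zero hp hb]
  · exact hk.symm

theorem _root_.LRAStar.State.Fits.b_le {p x : V} {f e : Entry V} (hF : S.Fits G Q p x f e) :
    f.b ≤ e.b := by
  obtain rfl | ⟨-, hb, -, rfl⟩ | ⟨-, -, hb⟩ := hF
  · simp
  · exact hb.le
  · omega

/-- Budgets and keys are monotone along the tree. -/
theorem le_of_mem_subtree (h : Inv G α S Q) {x y : V} (hy : y ∈ S.subtree x) :
    ∀ {e : Entry V}, S.node y = some e → ∃ f, S.node x = some f ∧ f.b ≤ e.b ∧ f.key ≤ e.key := by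
  induction hy with
  | refl => exact fun he => ⟨_, he, le_rfl, le_rfl⟩
  | tail _ hpy ih =>
    intro e he
    obtain ⟨e', he', hp⟩ := hpy
    obtain rfl : e = e' := by simpa [he] using he'
    obtain ⟨f, hf, -, hF⟩ := h.fits_of_parent he hp
    obtain ⟨g, hg, hgb, hgk⟩ := ih hf
    exact ⟨g, hg, hgb.trans hF.b_le, hgk.trans (by rw [h.key_eq hf hF]; exact le_self_add)⟩

theorem source_notMem_subtree (h : Inv G α S Q) {x : V} (hx : x ≠ G.source) :
    G.source ∉ S.subtree x := by
  intro hs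
  obtain hs | ⟨p, -, hp⟩ := Relation.ReflTransGen.cases_tail hs
  · exact hx hs.symm
  · exact h.source_not_child p hp

theorem exists_treePath (h : Inv G α S Q) {x : V} {e : Entry V} (hx : S.node x = some e) :
    ∃ P, S.TreePath x P := by
  obtain ⟨d, hd⟩ := h.acyclic
  induction hn : d x using Nat.strong_induction_on generalizing x e with
  | _ n ih =>
    cases hp : e.parent with
    | none => exact ⟨_, .root hx hp⟩
    | some p =>
      obtain ⟨f, hf, -, -⟩ := h.fits_of_parent hx hp
      obtain ⟨P, hP⟩ := ih (d p) (hn ▸ hd p x ⟨e, hx, hp⟩) hf rfl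
      exact ⟨_, .step hx hp hP⟩

theorem lazyReach_of_treePath (h : Inv G α S Q) {x : V} {P : List V} (hP : S.TreePath x P) :
    ∀ {e : Entry V}, S.node x = some e → LazyReach G S.edges x e.key := by
  induction hP with
  | root hx hp =>
    intro e he
    obtain rfl := Option.some.inj (hx.symm.trans he)
    obtain rfl := h.eq_source hx hp
    obtain rfl := Option.some.inj (h.source.symm.trans he)
    simpa [Entry.key] using LazyReach.source
  | step hx hp hP ih =>
    intro e he
    obtain rfl := Option.some.inj (hx.symm.trans he)
    obtain ⟨f, hf, hE, hF⟩ := h.fits_of_parent hx hp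
    rw [h.key_eq hf hF]
    exact .step (ih hf) hE

/-- Every key is realised by a walk, so a proposed extension is a walk to which `opt` applies. -/
theorem lazyReach (h : Inv G α S Q) {x : V} {e : Entry V} (hx : S.node x = some e) :
    LazyReach G S.edges x e.key := by
  obtain ⟨P, hP⟩ := h.exists_treePath hx
  exact h.lazyReach_of_treePath hP hx

/-- A node of budget zero cannot be improved. -/
theorem not_extends (h : Inv G α S Q) {p x : V} {e f : Entry V} (hx : S.node x = some f)
    (hb : f.b = 0) : ¬ S.Extends G α p e x := by
  rintro ⟨⟨hp, -, -, hE⟩, hlt⟩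
  have h1 := hlt f hx
  rw [Entry.child_key] at h1
  exact absurd (h.opt x f hx hb _ (.step (h.lazyReach hp) hE)) (not_le.2 h1)

theorem not_isParent_of_none (h : Inv G α S Q) {p x : V} (hp : S.node p = none) :
    ¬ S.IsParent p x := by
  rintro ⟨e, hx, hpar⟩
  obtain ⟨f, hf, -⟩ := h.fits_of_parent hx hpar
  simp [hp] at hf

/-! ### Preservation under insertion, removal and evaluation -/

theorem init (G : Problem V) (α : ℕ∞) : Inv G α (State.init G) ∅ := by
  have key : ∀ x e, (State.init G).node x = some e → x = G.source ∧ e = ⟨none, 0, 0, 0⟩ := by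
    intro x e hx
    by_cases hs : x = G.source
    · subst hs
      rw [State.init, setNode_self] at hx
      exact ⟨rfl, (Option.some.inj hx).symm⟩
    · simp [State.init, setNode, hs] at hx
  refine ⟨subset_rfl, fun e he _ => he, setNode_self _ _ _, fun x e hx hs => ?_, ⟨fun _ => 0, ?_⟩,
    fun x e hx _ k _ => ?_, fun x e hx => ?_⟩
  · exact absurd (key x e hx).1 hs
  · rintro p x ⟨e, hx, hp⟩
    simp [(key x e hx).2] at hp
  · simp [(key x e hx).2, Entry.key]
  · simp [(key x e hx).2]

/-- Inserting a new leaf keeps the invariant. -/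
theorem insert_leaf (h : Inv G α S ∅) {p x : V} {e : Entry V} (hx : S.node x = none)
    (hp : S.CanParent G α p e x) : Inv G α (S.setNode x (Entry.child G p e x)) ∅ := by
  obtain ⟨hpe, hb, -, hE⟩ := hp
  have hpx : p ≠ x := by rintro rfl; simp [hx] at hpe
  have hsx : G.source ≠ x := by rintro rfl; simp [h.source] at hx
  refine ⟨h.edges_sub, h.free_mem, ?_, fun y f hy hs => ?_, ?_, fun y f hy hb0 k hk => ?_,
    fun y f hy => ?_⟩
  · rw [setNode_of_ne _ _ hsx, h.source]
  · by_cases hyx : y = x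
    · subst hyx
      rw [setNode_self] at hy
      cases hy
      exact ⟨p, e, rfl, by rw [setNode_of_ne _ _ hpx, hpe], hE, Or.inl rfl⟩
    · rw [setNode_of_ne _ _ hyx] at hy
      obtain ⟨q, g, hq, hg, hE', hF⟩ := h.fits y f hy hs
      have hqx : q ≠ x := by rintro rfl; simp [hx] at hg
      refine ⟨q, g, hq, by rw [setNode_of_ne _ _ hqx, hg], hE', ?_⟩
      -- With nothing pending, `Fits` no longer depends on the state.
      simpa [Fits] using hF
  · classical
    obtain ⟨d, hd⟩ := h.acyclic
    -- The new leaf goes one level below `p`. It imposes no condition as a parent, since a vertex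
    -- without a node has no children.
    refine ⟨fun y => if y = x then d p + 1 else d y, ?_⟩
    rintro q y ⟨f, hy, hq⟩
    by_cases hyx : y = x
    · subst hyx
      rw [setNode_self] at hy
      cases hy
      obtain rfl : p = q := by simpa using hq
      simp [hpx]
    · rw [setNode_of_ne _ _ hyx] at hy
      have hqx : q ≠ x := by
        rintro rfl
        exact h.not_isParent_of_none hx ⟨f, hy, hq⟩
      simpa [hyx, hqx] using hd q y ⟨f, hy, hq⟩
  · by_cases hyx : y = x
    · subst hyx
      rw [setNode_self] at hy
      cases hy
      simp at hb0
    · rw [setNode_of_ne _ _ hyx] at hy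
      exact h.opt y f hy hb0 k hk
  · by_cases hyx : y = x
    · subst hyx
      rw [setNode_self] at hy
      cases hy
      simpa using Order.add_one_le_of_lt hb
    · rw [setNode_of_ne _ _ hyx] at hy
      exact h.budget y f hy

/-- Removing the subtree of a vertex other than the source keeps the invariant. -/
theorem remove_subtree (h : Inv G α S ∅) {v : V} (hv : v ≠ G.source) :
    Inv G α (S.removeNodes (S.subtree v)) ∅ := by
  refine ⟨h.edges_sub, h.free_mem, ?_, fun y f hy hs => ?_, ?_, fun y f hy => ?_, fun y f hy => ?_⟩
  · rw [removeNodes_of_notMem _ (h.source_notMem_subtree hv), h.source]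
  · rw [removeNodes_eq_some] at hy
    obtain ⟨q, g, hq, hg, hE', hF⟩ := h.fits y f hy.2 hs
    refine ⟨q, g, hq, removeNodes_eq_some.2 ⟨fun hqv => ?_, hg⟩, hE', ?_⟩
    · exact hy.1 (subtree_closed hqv ⟨f, hy.2, hq⟩)
    · simpa [Fits] using hF
  · obtain ⟨d, hd⟩ := h.acyclic
    refine ⟨d, ?_⟩
    rintro q y ⟨f, hy, hq⟩
    exact hd q y ⟨f, (removeNodes_eq_some.1 hy).2, hq⟩
  · exact h.opt y f (removeNodes_eq_some.1 hy).2
  · exact h.budget y f (removeNodes_eq_some.1 hy).2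

/-- Removing an edge that is in collision and not in the tree keeps the invariant. -/
theorem remove_edge (h : Inv G α S ∅) {u v : V} (hc : (u, v) ∈ G.collision)
    (hT : ¬ S.IsParent u v) : Inv G α (S.removeEdge (u, v)) ∅ := by
  refine ⟨fun e he => h.edges_sub he.1, fun e he hf => ⟨h.free_mem e he hf, ?_⟩, h.source,
    fun y f hy hs => ?_, h.acyclic, fun y f hy hb k hk => ?_, h.budget⟩
  · rintro rfl
    exact hf hc
  · obtain ⟨q, g, hq, hg, hE', hF⟩ := h.fits y f hy hs
    refine ⟨q, g, hq, hg, ⟨hE', ?_⟩, ?_⟩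
    · rintro ⟨⟩
      exact hT ⟨f, hy, hq⟩
    · simpa [Fits] using hF
  -- A smaller graph has fewer walks, so the lower bounds persist.
  · exact h.opt y f hy hb k (hk.mono fun e he => he.1)

/-- Marking a node of budget one, whose key is optimal, as evaluated. -/
theorem evaluate (h : Inv G α S ∅) {u v : V} {e : Entry V} (hu : S.node u = some e)
    (hb : e.b = 0) (hv : S.node v = some (Entry.child G u e v)) (hc : (u, v) ∉ G.collision)
    (hopt : ∀ k, LazyReach G S.edges v k → (Entry.child G u e v).key ≤ k) :
    Inv G α (S.setNode v ⟨some u, e.c + G.wHat (u, v), 0, 0⟩) {v} := by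
  obtain ⟨e', he', hE, -⟩ := h.fits_of_parent hv rfl
  have huv : u ≠ v := by
    rintro rfl
    have := congrArg Entry.b (Option.some.inj (hu.symm.trans hv))
    simp at this
  have hvs : v ≠ G.source := by
    rintro rfl
    rw [h.source] at hv
    have := congrArg Entry.b (Option.some.inj hv)
    simp at this
  have hpar : (S.setNode v ⟨some u, e.c + G.wHat (u, v), 0, 0⟩).IsParent = S.IsParent := by
    funext p x
    by_cases hx : x = v
    · subst hx
      simp [IsParent, setNode_self, hv]
    · simp [IsParent, setNode_of_ne _ _ hx]
  have hkey : (⟨some u, e.c + G.wHat (u, v), 0, 0⟩ : Entry V).key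
      = (Entry.child G u e v).key := by
    rw [Entry.child_key]
    simp [Entry.key, h.lazy_eq_zero hu hb]
  -- The old budget of `v` is one and budgets do not decrease down the tree, so nothing settled lies
  -- below `v`.
  have hnp : ∀ q g, S.node q = some g → g.b = 0 →
      ¬ (S.setNode v ⟨some u, e.c + G.wHat (u, v), 0, 0⟩).Pending {v} q := by
    rintro q g hq hg hP
    rw [Pending.congr hpar] at hP
    obtain ⟨_, rfl, hqv⟩ := hP
    obtain ⟨f, hf, hfb, -⟩ := h.le_of_mem_subtree hqv hq
    obtain rfl := Option.some.inj (hf.symm.trans hv)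
    simp [hg] at hfb
  refine ⟨h.edges_sub, h.free_mem, ?_, fun y f hy hs => ?_, hpar ▸ h.acyclic,
    fun y f hy hb0 k hk => ?_, fun y f hy => ?_⟩
  · rw [setNode_of_ne _ _ hvs.symm, h.source]
  · by_cases hyv : y = v
    · subst hyv
      rw [setNode_self] at hy
      cases hy
      exact ⟨u, e, rfl, by rw [setNode_of_ne _ _ huv, hu], hE, Or.inr (Or.inl ⟨hnp u e hu hb, hb, hc, rfl⟩)⟩
    · rw [setNode_of_ne _ _ hyv] at hy
      obtain ⟨q, g, hq, hg, hE', hF⟩ := h.fits y f hy hs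
      by_cases hqv : q = v
      · subst hqv
        -- A child of `v` becomes stale: its key still fits because that of `v` is unchanged, and
        -- its budget is at least the old budget of `v`, hence positive.
        refine ⟨q, _, hq, setNode_self _ _ _, hE', Or.inr (Or.inr ⟨⟨q, rfl, ?_⟩, ?_, ?_⟩)⟩
        · exact mem_subtree_self _ _
        · rw [hkey, h.key_eq hg hF]
          rw [hv] at hg
          cases hg
          rfl
        · rw [hv] at hg
          cases hg
          have := hF.b_le
          simp at this
          simp
          omega
      · refine ⟨q, g, hq, by rw [setNode_of_ne _ _ hqv, hg], hE', ?_⟩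
        obtain hF | hF | hF := hF
        · exact Or.inl hF
        · exact Or.inr (Or.inl ⟨hnp q g hg hF.2.1, hF.2⟩)
        · simp at hF
  · by_cases hyv : y = v
    · subst hyv
      rw [setNode_self] at hy
      cases hy
      rw [hkey]
      exact hopt k hk
    · rw [setNode_of_ne _ _ hyv] at hy
      exact h.opt y f hy hb0 k hk
  · by_cases hyv : y = v
    · subst hyv
      rw [setNode_self] at hy
      cases hy
      simp
    · rw [setNode_of_ne _ _ hyv] at hy
      exact h.budget y f hy

end Inv

/-! ### Updating descendants -/

theorem isParent_updateChildren (G : Problem V) (S : State V) (q : V) (e : Entry V) :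
    (S.updateChildren G q e).IsParent = S.IsParent := by
  funext p x
  by_cases hx : S.IsParent q x
  · have h1 : (S.updateChildren G q e).IsParent q x :=
      ⟨_, updateChildren_of_isParent e hx, rfl⟩
    exact propext ⟨fun h => h.eq h1 ▸ hx, fun h => h.eq hx ▸ h1⟩
  · simp [IsParent, updateChildren_of_not_isParent e hx]

/-- Replacing `q` by its children in the queue can only release `q` itself, since everything
strictly below `q` lies below a child. -/
theorem pending_of_pending_children {q p : V} (h : S.Pending Q p) (hpq : p ≠ q) :
    S.Pending ((Q \ {q}) ∪ {x | S.IsParent q x}) p := by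
  obtain ⟨r, hr, hp⟩ := h
  by_cases hrq : r = q
  · subst hrq
    obtain hp | ⟨x, hx, hxp⟩ := Relation.ReflTransGen.cases_head hp
    · exact absurd hp.symm hpq
    · exact ⟨x, Or.inr hx, hxp⟩
  · exact ⟨r, Or.inl ⟨hr, hrq⟩, hp⟩

theorem pending_of_children_pending {q p : V} (hq : q ∈ Q)
    (h : S.Pending ((Q \ {q}) ∪ {x | S.IsParent q x}) p) : S.Pending Q p := by
  obtain ⟨r, hr | hr, hp⟩ := h
  · exact ⟨r, hr.1, hp⟩
  · exact ⟨q, hq, Relation.ReflTransGen.head hr hp⟩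

namespace Inv

/-- The antichain condition keeps `q` from lying below another member of `Q`, and acyclicity from
lying below its own children. So the pending set shrinks strictly, which ends the update phase. -/
theorem not_pending_children (h : Inv G α S Q) {q : V}
    (hQ : ∀ a ∈ Q, ∀ b ∈ Q, b ∈ S.subtree a → a = b) (hq : q ∈ Q) :
    ¬ S.Pending ((Q \ {q}) ∪ {x | S.IsParent q x}) q := by
  rintro ⟨r, ⟨hr, hne⟩ | hr, hqr⟩
  · exact hne (hQ r hr q hq hqr)
  · obtain ⟨d, hd⟩ := h.acyclic
    have hle : ∀ {a b}, b ∈ S.subtree a → d a ≤ d b := by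
      intro a b hab
      induction hab with
      | refl => exact le_rfl
      | tail _ hx ih => exact ih.trans (hd _ _ hx).le
    exact absurd (hd q r hr) (not_lt.2 (hle hqr))

/-- The vertices that are still to be processed remain incomparable in the tree. -/
theorem antichain_children (h : Inv G α S Q) {q : V}
    (hQ : ∀ a ∈ Q, ∀ b ∈ Q, b ∈ S.subtree a → a = b) (hq : q ∈ Q) :
    ∀ a ∈ (Q \ {q}) ∪ {x | S.IsParent q x}, ∀ b ∈ (Q \ {q}) ∪ {x | S.IsParent q x},
      b ∈ S.subtree a → a = b := by
  intro a ha b hb hab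
  have hnp := h.not_pending_children hQ hq
  obtain hb | hb := hb
  · obtain ha' | ha' := ha
    · exact hQ a ha'.1 b hb.1 hab
    · exact absurd (hQ q hq b hb.1 (Relation.ReflTransGen.head ha' hab)).symm hb.2
  · obtain hab | ⟨p, hp, hpb⟩ := Relation.ReflTransGen.cases_tail hab
    · exact hab.symm
    -- The parent of `b` is `q`, so `q` would lie below `a` and still be pending.
    · obtain rfl := IsParent.eq hpb hb
      exact absurd ⟨a, ha, hp⟩ hnp

/-- The budgets strictly below the nodes that are still to be processed are positive. -/
theorem b_lt_of_pending (h : Inv G α S Q) {q x : V} {e f : Entry V} (hq : S.node q = some e)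
    (hqQ : S.Pending Q q) (hx : S.node x = some f) (hp : f.parent = some q) : e.b + 1 ≤ f.b := by
  obtain ⟨e', he', -, hF⟩ := h.fits_of_parent hx hp
  obtain rfl : e = e' := by simpa [hq] using he'
  obtain rfl | ⟨hn, -⟩ | ⟨-, -, hb⟩ := hF
  · simp
  · exact absurd hqQ hn
  · exact hb

/-- Updating the children of a node keeps the invariant. -/
theorem update (h : Inv G α S Q) {q : V} {e : Entry V} (hq : S.node q = some e) (hqQ : q ∈ Q) :
    Inv G α (S.updateChildren G q e) ((Q \ {q}) ∪ {x | S.IsParent q x}) := by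
  have hpar := isParent_updateChildren G S q e
  have hpend : S.Pending Q q := ⟨q, hqQ, mem_subtree_self _ _⟩
  have hqq : ¬ S.IsParent q q := fun hp => by
    obtain ⟨d, hd⟩ := h.acyclic
    exact lt_irrefl _ (hd q q hp)
  refine ⟨h.edges_sub, h.free_mem, ?_, fun y f hy hs => ?_, hpar ▸ h.acyclic,
    fun y f hy hb0 k hk => ?_, fun y f hy => ?_⟩
  · rw [updateChildren_of_not_isParent _ (h.source_not_child q), h.source]
  · by_cases hyq : S.IsParent q y
    · rw [updateChildren_of_isParent _ hyq] at hy
      obtain rfl := Option.some.inj hy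
      obtain ⟨g, hg, hgq⟩ := hyq
      obtain ⟨-, -, hE, -⟩ := h.fits_of_parent hg hgq
      exact ⟨q, e, rfl, by rw [updateChildren_of_not_isParent _ hqq, hq], hE, Or.inl rfl⟩
    · rw [updateChildren_of_not_isParent _ hyq] at hy
      obtain ⟨p, g, hp, hg, hE, hF⟩ := h.fits y f hy hs
      have hpq : p ≠ q := by
        rintro rfl
        exact hyq ⟨f, hy, hp⟩
      by_cases hqp : S.IsParent q p
      -- Here `y` is a grandchild of `q` whose parent has just been rewritten. The key of that
      -- parent is unchanged, and the old budgets rise by at least one on each of the two levels.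
      · have hpp : S.Pending Q p := pending_of_children_pending hqQ
          ⟨p, Or.inr hqp, mem_subtree_self _ _⟩
        have hbf := h.b_lt_of_pending hg hpp hy hp
        obtain ⟨g', hg', hgq⟩ := hqp
        obtain rfl : g = g' := by simpa [hg] using hg'
        have hbg := h.b_lt_of_pending hq hpend hg hgq
        obtain ⟨e', he', -, hF'⟩ := h.fits_of_parent hg hgq
        obtain rfl : e = e' := by simpa [hq] using he'
        refine ⟨p, _, hp, updateChildren_of_isParent _ ⟨g, hg, hgq⟩, hE, Or.inr (Or.inr ⟨?_, ?_, ?_⟩)⟩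
        · exact ⟨p, Or.inr ⟨g, hg, hgq⟩, mem_subtree_self _ _⟩
        · rw [h.key_eq hg hF, h.key_eq hq hF', Entry.child_key]
        · rw [Entry.child_b]
          omega
      · refine ⟨p, g, hp, by rw [updateChildren_of_not_isParent _ hqp, hg], hE, ?_⟩
        unfold Fits
        rw [Pending.congr hpar]
        obtain hF | hF | hF := hF
        · exact Or.inl hF
        · exact Or.inr (Or.inl ⟨fun hP => hF.1 (pending_of_children_pending hqQ hP), hF.2⟩)
        · exact Or.inr (Or.inr ⟨pending_of_pending_children hF.1 hpq, hF.2⟩)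
  · by_cases hyq : S.IsParent q y
    · rw [updateChildren_of_isParent _ hyq] at hy
      obtain rfl := Option.some.inj hy
      simp at hb0
    · rw [updateChildren_of_not_isParent _ hyq] at hy
      exact h.opt y f hy hb0 k hk
  · by_cases hyq : S.IsParent q y
    · rw [updateChildren_of_isParent _ hyq] at hy
      obtain rfl := Option.some.inj hy
      obtain ⟨g, hg, hgq⟩ := hyq
      -- Recomputation never raises a budget.
      refine le_trans ?_ (h.budget y g hg)
      exact_mod_cast h.b_lt_of_pending hq hpend hg hgq
    · rw [updateChildren_of_not_isParent _ hyq] at hy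
      exact h.budget y f hy

end Inv
end State

/-! ### True and lazy costs of paths -/

theorem zip_tail_concat (P : List V) (p x : V) :
    (P ++ [p] ++ [x]).zip (P ++ [p] ++ [x]).tail
      = (P ++ [p]).zip (P ++ [p]).tail ++ [(p, x)] := by
  induction P with
  | nil => rfl
  | cons a P ih =>
    cases P with
    | nil => rfl
    | cons b P => simpa using ih

namespace Problem

theorem w_of_notMem {e : V × V} (h : e ∉ G.collision) : G.w e = G.wHat e := by simp [w, h]

theorem w_of_mem {e : V × V} (h : e ∈ G.collision) : G.w e = ⊤ := by simp [w, h]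

theorem w_eq_wHat_iff {e : V × V} : G.w e = G.wHat e ↔ e ∉ G.collision :=
  ⟨fun h he => by simp [w_of_mem he] at h, w_of_notMem⟩

/-- The lazy cost of a path: the sum of the lazy estimates of its edges. -/
def lazyCost (G : Problem V) (P : List V) : ℝ≥0 := ((P.zip P.tail).map G.wHat).sum

theorem lazyCost_concat (P : List V) (p x : V) :
    G.lazyCost (P ++ [p] ++ [x]) = G.lazyCost (P ++ [p]) + G.wHat (p, x) := by
  simp only [lazyCost, zip_tail_concat, List.map_append, List.sum_append, List.map_cons,
    List.map_nil, List.sum_cons, List.sum_nil, add_zero]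

theorem cost_eq_lazyCost {P : List V} (h : G.CollisionFree P) : G.cost P = G.lazyCost P := by
  have : ∀ l : List (V × V), (∀ e ∈ l, e ∉ G.collision) →
      (l.map G.w).sum = ((l.map G.wHat).sum : ℝ≥0) := by
    intro l hl
    induction l with
    | nil => simp
    | cons a l ih =>
      rw [List.forall_mem_cons] at hl
      simp [ih hl.2, w_of_notMem hl.1]
  exact this _ h

theorem cost_eq_top {P : List V} (h : ¬ G.CollisionFree P) : G.cost P = ⊤ := by
  simp only [CollisionFree, not_forall, not_not] at h
  obtain ⟨e, he, hc⟩ := h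
  have hle := List.single_le_sum (l := (P.zip P.tail).map G.w) (fun _ _ => zero_le) (G.w e)
    (List.mem_map_of_mem he)
  rw [w_of_mem hc] at hle
  exact top_le_iff.1 hle

theorem CollisionFree.concat {P : List V} {p x : V} :
    G.CollisionFree (P ++ [p] ++ [x]) ↔ G.CollisionFree (P ++ [p]) ∧ (p, x) ∉ G.collision := by
  simp only [CollisionFree, zip_tail_concat, List.mem_append, List.mem_singleton, or_imp,
    forall_and, forall_eq]

theorem isPathTo_concat {P : List V} {p x : V} :
    G.IsPathTo x (P ++ [p] ++ [x]) ↔ G.IsPathTo p (P ++ [p]) ∧ (p, x) ∈ G.edges := by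
  simp [IsPathTo, List.isChain_append, and_assoc]
  tauto

/-- This turns lower bounds over lazy walks in the current graph into lower bounds over all
collision-free paths of the original graph. -/
theorem IsPathTo.lazyReach {E : Set (V × V)}
    (hE : ∀ e ∈ G.edges, e ∉ G.collision → e ∈ E) {P : List V} :
    ∀ {v : V}, G.IsPathTo v P → G.CollisionFree P → LazyReach G E v (G.lazyCost P) := by
  induction P using List.reverseRecOn with
  | nil => intro v h; simp [IsPathTo] at h
  | append_singleton P x ih =>
    intro v h hf
    obtain rfl : x = v := by simpa using h.2.1
    cases P using List.reverseRecOn with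
    | nil =>
      obtain rfl : x = G.source := by simpa using h.1
      simpa [lazyCost] using LazyReach.source
    | append_singleton P p =>
      rw [isPathTo_concat] at h
      rw [CollisionFree.concat] at hf
      rw [lazyCost_concat]
      exact .step (ih h.1 hf.1) (hE _ h.2 hf.2)

end Problem

/-! ### Tree paths, optimality and the selected edge -/

namespace State

theorem TreePath.eq_concat {x : V} {P : List V} (h : S.TreePath x P) : ∃ P', P = P' ++ [x] := by
  cases h with
  | root => exact ⟨[], rfl⟩
  | step => exact ⟨_, rfl⟩

namespace Inv

theorem isPathTo (h : Inv G α S Q) {x : V} {P : List V} (hP : S.TreePath x P) :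
    G.IsPathTo x P := by
  induction hP with
  | root hx hp =>
    obtain rfl := h.eq_source hx hp
    simp [Problem.IsPathTo]
  | step hx hp hP ih =>
    obtain ⟨P', rfl⟩ := hP.eq_concat
    obtain ⟨f, -, hE, -⟩ := h.fits_of_parent hx hp
    exact Problem.isPathTo_concat.2 ⟨ih, h.edges_sub hE⟩

theorem key_eq_lazyCost (h : Inv G α S Q) {x : V} {P : List V} (hP : S.TreePath x P) :
    ∀ {e : Entry V}, S.node x = some e → e.key = G.lazyCost P := by
  induction hP with
  | root hx hp =>
    intro e he
    obtain rfl := h.eq_source hx hp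
    obtain rfl := Option.some.inj (h.source.symm.trans he)
    simp [Entry.key, Problem.lazyCost]
  | step hx hp hP ih =>
    intro e he
    obtain rfl := Option.some.inj (hx.symm.trans he)
    obtain ⟨P', rfl⟩ := hP.eq_concat
    obtain ⟨f, hf, -, hF⟩ := h.fits_of_parent hx hp
    rw [h.key_eq hf hF, ih hf, Problem.lazyCost_concat]

/-- Depth increases strictly towards the end of a tree path. With `key_eq_lazyCost` this confines
the keys to a finite set. -/
theorem nodup (h : Inv G α S Q) {x : V} {P : List V} (hP : S.TreePath x P) : P.Nodup := by
  obtain ⟨d, hd⟩ := h.acyclic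
  suffices P.Nodup ∧ ∀ y ∈ P, d y ≤ d x from this.1
  induction hP with
  | root => simp
  | @step x p e P hx hp hP ih =>
    have hlt := hd _ _ ⟨_, hx, hp⟩
    have hlt' : ∀ y ∈ P, d y < d x := fun y hy => (ih.2 y hy).trans_lt hlt
    refine ⟨?_, fun y hy => ?_⟩
    · rw [List.nodup_append]
      refine ⟨ih.1, List.nodup_singleton _, fun a ha b hb => ?_⟩
      rintro rfl
      obtain rfl := List.mem_singleton.1 hb
      exact lt_irrefl _ (hlt' _ ha)
    · obtain hy | hy := List.mem_append.1 hy
      · exact (hlt' y hy).le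
      · rw [List.mem_singleton.1 hy]

/-- Budget zero leaves only the evaluated alternative of `Fits`, which makes the last edge free and
the parent settled again. -/
theorem collisionFree (h : Inv G α S Q) {x : V} {P : List V} (hP : S.TreePath x P) :
    ∀ {e : Entry V}, S.node x = some e → e.b = 0 → G.CollisionFree P := by
  induction hP with
  | root hx hp => simp [Problem.CollisionFree]
  | step hx hp hP ih =>
    intro e he hb
    obtain rfl := Option.some.inj (hx.symm.trans he)
    obtain ⟨P', rfl⟩ := hP.eq_concat
    obtain ⟨f, hf, -, hF⟩ := h.fits_of_parent hx hp
    obtain rfl | ⟨-, hfb, hc, -⟩ | ⟨-, -, hb'⟩ := hF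
    · simp at hb
    · exact Problem.CollisionFree.concat.2 ⟨ih hf hfb, hc⟩
    · omega

/-- The tree path of a node of budget zero is a shortest collision-free path. -/
theorem isShortestFreePath (h : Inv G α S Q) {x : V} {e : Entry V} {P : List V}
    (hx : S.node x = some e) (hb : e.b = 0) (hP : S.TreePath x P) :
    G.IsShortestFreePath x P ∧ G.cost P = G.wStar x ∧ (e.c : ℝ≥0∞) = G.wStar x := by
  have hfree := h.collisionFree hP hx hb
  have hkey : (e.c : ℝ≥0∞) = G.cost P := by
    rw [Problem.cost_eq_lazyCost hfree, ← h.key_eq_lazyCost hP hx, Entry.key,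
      h.lazy_eq_zero hx hb, add_zero]
  have hmin : ∀ R, G.IsPathTo x R → G.cost P ≤ G.cost R := by
    intro R hR
    by_cases hRf : G.CollisionFree R
    · rw [Problem.cost_eq_lazyCost hfree, Problem.cost_eq_lazyCost hRf,
        ← h.key_eq_lazyCost hP hx]
      exact_mod_cast h.opt x e hx hb _ (hR.lazyReach h.free_mem hRf)
    · rw [Problem.cost_eq_top hRf]
      exact le_top
  have hstar : G.cost P = G.wStar x :=
    le_antisymm (le_iInf₂ hmin) (iInf₂_le P (h.isPathTo hP))
  exact ⟨⟨h.isPathTo hP, hfree, fun R hR _ => hmin R hR⟩, hstar, hkey.trans hstar⟩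

/-- When no node can be extended, every walk to `x` is at least as expensive as the node of `x` or
as some frontier node. -/
theorem covered (h : Inv G α S Q) (hE : ∀ p e x, ¬ S.Extends G α p e x) {x : V} {k : ℝ≥0}
    (hk : LazyReach G S.edges x k) :
    (∃ e, S.node x = some e ∧ e.key ≤ k) ∨ ∃ y e, S.InFrontier G α y e ∧ e.key ≤ k := by
  induction hk with
  | source => exact Or.inl ⟨_, h.source, by simp [Entry.key]⟩
  | @step p x k hp hx ih =>
    obtain ⟨e, he, hek⟩ | ⟨y, e, hy, hek⟩ := ih
    · by_cases hfr : S.InFrontier G α p e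
      · exact Or.inr ⟨p, e, hfr, hek.trans le_self_add⟩
      -- Outside the frontier `p` is extensible, and as no extension is left, `x` has a node at most
      -- as expensive as the way through `p`.
      · simp only [InFrontier, he, true_and, not_or] at hfr
        have hcan : S.CanParent G α p e x := ⟨he, (h.budget p e he).lt_of_ne hfr.1, hfr.2, hx⟩
        have hn := hE p e x
        simp only [Extends, hcan, true_and, not_forall, not_lt] at hn
        obtain ⟨f, hf, hle⟩ := hn
        refine Or.inl ⟨f, hf, hle.trans ?_⟩
        rw [Entry.child_key]
        gcongr
    · exact Or.inr ⟨y, e, hy, hek.trans le_self_add⟩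

/-- The tail of a tree path consists of unevaluated edges, and starts at a node of budget zero. -/
theorem tail_spec (h : Inv G α S ∅) {x : V} {P : List V} (hP : S.TreePath x P) :
    ∀ {e : Entry V} {pre rest : List V} {u : V}, S.node x = some e → P = pre ++ u :: rest →
      rest.length = e.b → ∃ f, S.node u = some f ∧ f.b = 0 ∧
        ∀ v rest', rest = v :: rest' → S.node v = some (Entry.child G u f v) ∧
          (Entry.child G u f v).key ≤ e.key := by
  induction hP with
  | @root x _ hx hp =>
    intro e pre rest u he hP hlen
    obtain ⟨rfl, rfl⟩ : x = u ∧ rest = [] := by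
      cases pre <;> simp at hP
      exact ⟨hP.1, hP.2⟩
    exact ⟨e, he, hlen.symm, by simp⟩
  | @step x p e' P hx hp hP ih =>
    intro e pre rest u he hPe hlen
    obtain rfl := Option.some.inj (hx.symm.trans he)
    cases rest using List.reverseRecOn with
    | nil =>
      obtain ⟨-, rfl⟩ : P = pre ∧ x = u := by simpa using hPe
      exact ⟨_, he, hlen.symm, by simp⟩
    | append_singleton rest y =>
      rw [← List.cons_append, ← List.append_assoc] at hPe
      obtain ⟨hPu, hxy⟩ := List.append_inj' hPe rfl
      obtain rfl : x = y := by simpa using hxy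
      obtain ⟨f, hf, -, hF⟩ := h.fits_of_parent hx hp
      have hkey := h.key_eq hf hF
      -- A nonempty tail means a positive budget, which excludes an evaluated last edge; nothing is
      -- pending.
      have hchild : e' = Entry.child G p f x := by
        obtain hF | ⟨-, -, -, rfl⟩ | ⟨hF, -⟩ := hF
        · exact hF
        · simp at hlen
        · simp at hF
      have hlen' : rest.length = f.b := by
        rw [hchild] at hlen
        simpa using hlen
      obtain ⟨g, hg, hgb, hspec⟩ := ih hf hPu hlen'
      refine ⟨g, hg, hgb, fun v rest' hv => ?_⟩
      cases rest with
      | nil =>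
        obtain ⟨rfl, -⟩ : x = v ∧ _ := by simpa using hv
        obtain ⟨P', rfl⟩ := hP.eq_concat
        obtain ⟨-, rfl⟩ : P' = pre ∧ p = u := by simpa using hPu
        obtain rfl := Option.some.inj (hf.symm.trans hg)
        exact ⟨hchild ▸ hx, by rw [hchild]⟩
      | cons z rest =>
        obtain ⟨rfl, -⟩ : z = v ∧ _ := by simpa using hv
        obtain ⟨h1, h2⟩ := hspec z rest rfl
        exact ⟨h1, h2.trans (by rw [hkey]; exact le_self_add)⟩

/-- The edge selected for evaluation leads from a node of budget zero to an unevaluated node, the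
key of which is the lazy distance in the current graph. -/
theorem selects_spec (h : Inv G α S ∅) (hE : ∀ p e x, ¬ S.Extends G α p e x) {u v : V}
    (hs : S.Selects G α u v) :
    ∃ f, S.node u = some f ∧ f.b = 0 ∧ S.node v = some (Entry.child G u f v) ∧
      ∀ k, LazyReach G S.edges v k → (Entry.child G u f v).key ≤ k := by
  obtain ⟨x, e, hfr, hmin, pre, rest, hP, hlen⟩ := hs
  obtain ⟨f, hf, hfb, hspec⟩ := h.tail_spec hP hfr.1 rfl hlen
  obtain ⟨hv, hle⟩ := hspec v rest rfl
  refine ⟨f, hf, hfb, hv, fun k hk => ?_⟩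
  obtain ⟨e', he', hek⟩ | ⟨y, e', hy, hek⟩ := h.covered hE hk
  · obtain rfl := Option.some.inj (hv.symm.trans he')
    exact hek
  · exact hle.trans ((hmin y e' hy).trans hek)

theorem b_le_length (h : Inv G α S ∅) {x : V} {P : List V} (hP : S.TreePath x P) :
    ∀ {e : Entry V}, S.node x = some e → e.b + 1 ≤ P.length := by
  induction hP with
  | root hx hp =>
    intro e he
    obtain rfl := h.eq_source hx hp
    obtain rfl := Option.some.inj (h.source.symm.trans he)
    simp
  | step hx hp hP ih =>
    intro e he
    obtain rfl := Option.some.inj (hx.symm.trans he)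
    obtain ⟨f, hf, -, hF⟩ := h.fits_of_parent hx hp
    have := ih hf
    obtain rfl | ⟨-, -, -, rfl⟩ | ⟨hF, -⟩ := hF
    · simpa using this
    · simp
    · simp at hF

/-- If the frontier is not empty, an edge can be selected. -/
theorem exists_selects [Finite V] (hα : 1 ≤ α) (h : Inv G α S ∅)
    (hT : ∀ e, S.node G.target = some e → e.b ≠ 0)
    (hfr : ∃ x e, S.InFrontier G α x e) : ∃ u v, S.Selects G α u v := by
  obtain ⟨x₀, e₀, h₀⟩ := hfr
  obtain ⟨x, ⟨e, hx⟩, hmin⟩ := Set.exists_min_image {x | ∃ e, S.InFrontier G α x e}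
    -- The default 0 is never used: frontier vertices have nodes.
    (fun x => ((S.node x).map Entry.key).getD 0) (Set.toFinite _) ⟨x₀, e₀, h₀⟩
  have hb : e.b ≠ 0 := by
    obtain ⟨hxe, hb | rfl⟩ := hx
    · intro h0
      rw [h0] at hb
      rw [← hb] at hα
      simp at hα
    · exact hT e hxe
  obtain ⟨P, hP⟩ := h.exists_treePath hx.1
  have hlen := h.b_le_length hP hx.1
  -- The tail has `e.b` edges, hence `e.b + 1` vertices, the first of which is `u`.
  have hdrop : (P.drop (P.length - (e.b + 1))).length = e.b + 1 := by
    rw [List.length_drop]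
    omega
  have htd := List.take_append_drop (P.length - (e.b + 1)) P
  match hD : P.drop (P.length - (e.b + 1)), hdrop with
  | [], hdrop => simp at hdrop
  | [u], hdrop => simp at hdrop; omega
  | u :: v :: rest, hdrop =>
    rw [hD] at htd
    refine ⟨u, v, x, e, hx, fun y f hy => ?_, _, rest, htd.symm ▸ hP, by simpa using hdrop⟩
    have := hmin y ⟨f, hy⟩
    simpa only [hx.1, hy.1, Option.map_some, Option.getD_some] using this

end Inv
end State

/-! ### Settled nodes are permanent -/

namespace State

/-- The state in which the node of `x` has been replaced by a child of `p`. -/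
noncomputable abbrev extendBy (G : Problem V) (S : State V) (p : V) (e : Entry V) (x : V) :
    State V :=
  (S.removeNodes (S.subtree x)).setNode x (Entry.child G p e x)

/-- The nodes of budget zero of `S` are nodes of `S'`, with the same entries. -/
def KeepsSettled (S S' : State V) : Prop :=
  ∀ x e, S.node x = some e → e.b = 0 → S'.node x = some e

/-- The target is not yet reached by an evaluated path. -/
def TargetOpen (G : Problem V) (S : State V) : Prop :=
  ∀ e, S.node G.target = some e → e.b ≠ 0

theorem TargetOpen.setNode (h : S.TargetOpen G) {x : V} {e : Entry V}
    (he : x = G.target → e.b ≠ 0) : (S.setNode x e).TargetOpen G := by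
  intro f hf
  by_cases hx : x = G.target
  · subst hx
    rw [setNode_self] at hf
    cases hf
    exact he rfl
  · rw [setNode_of_ne _ _ (Ne.symm hx)] at hf
    exact h f hf

theorem TargetOpen.removeNodes (h : S.TargetOpen G) (R : Set V) :
    (S.removeNodes R).TargetOpen G :=
  fun e he => h e (removeNodes_eq_some.1 he).2

theorem TargetOpen.updateChildren (h : S.TargetOpen G) (q : V) (e : Entry V) :
    (S.updateChildren G q e).TargetOpen G := by
  intro f hf
  by_cases hx : S.IsParent q G.target
  · rw [updateChildren_of_isParent _ hx] at hf
    cases hf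
    simp
  · rw [updateChildren_of_not_isParent _ hx] at hf
    exact h f hf

namespace Inv

/-- A descendant of `x` has at least the key of `x`, and estimates are nonnegative, so a detour
through it cannot be cheaper. Hence `p` survives the removal and no cycle arises. -/
theorem notMem_subtree_of_extends (h : Inv G α S Q) {p x : V} {e : Entry V}
    (hx : S.Extends G α p e x) : p ∉ S.subtree x := by
  intro hp
  obtain ⟨f, hf, -, hk⟩ := h.le_of_mem_subtree hp hx.1.1
  have := hx.2 f hf
  rw [Entry.child_key] at this
  exact absurd (hk.trans le_self_add) (not_le.2 this)

theorem ne_source_of_extends (h : Inv G α S Q) {p x : V} {e : Entry V}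
    (hx : S.Extends G α p e x) : x ≠ G.source := by
  rintro rfl
  exact h.not_extends h.source rfl hx

theorem extend (h : Inv G α S ∅) {p x : V} {e : Entry V} (hx : S.Extends G α p e x) :
    Inv G α (S.extendBy G p e x) ∅ := by
  refine (h.remove_subtree (h.ne_source_of_extends hx)).insert_leaf
    (removeNodes_of_mem _ (mem_subtree_self _ _)) ⟨?_, hx.1.2⟩
  exact removeNodes_eq_some.2 ⟨h.notMem_subtree_of_extends hx, hx.1.1⟩

/-- A settled node below `x` would make `x` settled, by monotonicity of budgets, and a settled node
cannot be improved. -/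
theorem extend_keepsSettled (h : Inv G α S ∅) {p x : V} {e : Entry V}
    (hx : S.Extends G α p e x) : S.KeepsSettled (S.extendBy G p e x) := by
  intro y f hy hb
  have hyx : y ∉ S.subtree x := by
    intro hmem
    obtain ⟨g, hg, hgb, -⟩ := h.le_of_mem_subtree hmem hy
    exact h.not_extends hg (by omega) hx
  have hne : y ≠ x := by
    rintro rfl
    exact hyx (mem_subtree_self _ _)
  rw [setNode_of_ne _ _ hne]
  exact removeNodes_eq_some.2 ⟨hyx, hy⟩

theorem subtree_removal_keepsSettled (h : Inv G α S ∅) {v : V} {f : Entry V}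
    (hv : S.node v = some f) (hb : f.b ≠ 0) (E : V × V) :
    S.KeepsSettled ((S.removeEdge E).removeNodes (S.subtree v)) := by
  intro y g hy hgb
  refine removeNodes_eq_some.2 ⟨fun hmem => ?_, hy⟩
  obtain ⟨f', hf', hfb, -⟩ := h.le_of_mem_subtree hmem hy
  obtain rfl := Option.some.inj (hv.symm.trans hf')
  omega

theorem collide (h : Inv G α S ∅) {u v : V} {f : Entry V}
    (hv : S.node v = some (Entry.child G u f v)) (hc : (u, v) ∈ G.collision) :
    Inv G α ((S.removeEdge (u, v)).removeNodes (S.subtree v)) ∅ := by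
  have hvs : v ≠ G.source := by
    rintro rfl
    have := congrArg Entry.b (Option.some.inj (h.source.symm.trans hv))
    simp at this
  -- The two removals commute definitionally; once the subtree is gone, `(u, v)` is not a tree edge.
  refine (h.remove_subtree hvs).remove_edge hc ?_
  rintro ⟨e, he, -⟩
  rw [removeNodes_of_mem _ (mem_subtree_self _ _)] at he
  cases he

theorem updateChildren_keepsSettled (h : Inv G α S Q) {q : V} {e : Entry V} (hq : q ∈ Q)
    (he : S.node q = some e) : S.KeepsSettled (S.updateChildren G q e) := by
  intro y f hy hb
  rw [updateChildren_of_not_isParent _ _, hy]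
  rintro ⟨f', hf', hp⟩
  obtain rfl := Option.some.inj (hy.symm.trans hf')
  have := h.b_lt_of_pending he ⟨q, hq, mem_subtree_self _ _⟩ hy hp
  omega

end Inv

theorem keepsSettled_setNode {v : V} {e : Entry V} (hv : ∀ f, S.node v = some f → f.b ≠ 0) :
    S.KeepsSettled (S.setNode v e) := by
  intro y f hy hb
  rw [setNode_of_ne _ _ ?_, hy]
  rintro rfl
  exact hv f hy hb

end State

open State

/-! ### The invariant along an execution -/

/-- The invariant of the algorithm. -/
def ConfigInv (G : Problem V) (α : ℕ∞) : Config V → Prop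
  | .extend S => S.Inv G α ∅ ∧ S.TargetOpen G
  | .search S => S.Inv G α ∅ ∧ S.TargetOpen G ∧ ∀ p e x, ¬ S.Extends G α p e x
  | .foundFree u v S => S.Inv G α {v} ∧ (∃ c, S.node v = some ⟨some u, c, 0, 0⟩) ∧
      (v ≠ G.target → S.TargetOpen G)
  | .update Q S => S.Inv G α Q ∧ S.TargetOpen G ∧ (∀ a ∈ Q, ∀ b ∈ Q, b ∈ S.subtree a → a = b) ∧
      ∀ q ∈ Q, ∃ e, S.node q = some e
  | .rewire R S => S.Inv G α ∅ ∧ S.TargetOpen G ∧ ∀ x ∈ R, S.node x = none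
  | .returned P => G.IsShortestFreePath G.target P ∧ G.cost P = G.wStar G.target
  | .failure => ¬ ∃ P, G.IsPathTo G.target P ∧ G.CollisionFree P

theorem configInv_start (G : Problem V) (hst : G.source ≠ G.target) (α : ℕ∞) :
    ConfigInv G α (start G) := by
  refine ⟨Inv.init G α, fun e he => ?_⟩
  simp [State.init, setNode, hst.symm] at he

theorem ConfigInv.step {κ κ' : Config V} (h : ConfigInv G α κ) (hs : Step G α κ κ') :
    ConfigInv G α κ' := by
  cases hs with
  | extendNode hx =>
    exact ⟨h.1.extend hx, (h.2.removeNodes _).setNode fun _ => by simp⟩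
  | extendDone hx => exact ⟨h.1, h.2, hx⟩
  | @fail S hfr =>
    rintro ⟨P, hP, hf⟩
    -- A free path would yield a node of the target, which is in the frontier whatever its budget,
    -- or some other frontier node.
    obtain ⟨e, he, -⟩ | ⟨y, e, hy, -⟩ := h.1.covered h.2.2 (hP.lazyReach h.1.free_mem hf)
    · exact hfr _ e ⟨he, Or.inr rfl⟩
    · exact hfr y e hy
  | @evalFree S u v e hsel hu hw =>
    obtain ⟨f, hf, hfb, hv, hopt⟩ := h.1.selects_spec h.2.2 hsel
    obtain rfl := Option.some.inj (hu.symm.trans hf)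
    exact ⟨h.1.evaluate hu hfb hv (Problem.w_eq_wHat_iff.1 hw) hopt, ⟨_, setNode_self _ _ _⟩,
      fun hne => h.2.1.setNode fun heq => absurd heq hne⟩
  | @evalCollision S u v hsel hw =>
    obtain ⟨f, hf, hfb, hv, hopt⟩ := h.1.selects_spec h.2.2 hsel
    have hc : (u, v) ∈ G.collision := not_not.1 fun hc => hw (Problem.w_eq_wHat_iff.2 hc)
    exact ⟨h.1.collide hv hc, TargetOpen.removeNodes (S := S.removeEdge (u, v)) h.2.1 _,
      fun x hx => removeNodes_of_mem _ hx⟩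
  | ret hv hP =>
    subst hv
    obtain ⟨c, hc⟩ := h.2.1
    obtain ⟨h1, h2, -⟩ := h.1.isShortestFreePath hc rfl hP
    exact ⟨h1, h2⟩
  | startUpdate hv =>
    obtain ⟨hI, ⟨c, hc⟩, hT⟩ := h
    refine ⟨hI, hT hv, ?_, ?_⟩
    · rintro a rfl b rfl -
      rfl
    · rintro q rfl
      exact ⟨_, hc⟩
  | @updateNode S Q q e hq he =>
    obtain ⟨hI, hT, hA, hN⟩ := h
    refine ⟨hI.update he hq, hT.updateChildren q e, ?_, ?_⟩
    · have := hI.antichain_children hA hq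
      simpa only [subtree, isParent_updateChildren] using this
    · intro x hx
      by_cases hqx : S.IsParent q x
      · exact ⟨_, updateChildren_of_isParent _ hqx⟩
      · rw [updateChildren_of_not_isParent _ hqx]
        obtain hx | hx := hx
        · exact hN x hx.1
        · exact absurd hx hqx
  | updateDone => exact ⟨h.1, h.2.1⟩
  | @rewireNode S R p x e hx hp hmin =>
    refine ⟨h.1.insert_leaf (h.2.2 x hx) hp, h.2.1.setNode fun _ => by simp, fun y hy => ?_⟩
    rw [setNode_of_ne _ _ hy.2]
    exact h.2.2 y hy.1
  | rewireDone => exact ⟨h.1, h.2.1⟩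

theorem ConfigInv.reaches {κ κ' : Config V} (h : ConfigInv G α κ) (hr : Reaches G α κ κ') :
    ConfigInv G α κ' := by
  induction hr with
  | refl => exact h
  | tail _ hs ih => exact ih.step hs

theorem ConfigInv.inv {κ : Config V} (h : ConfigInv G α κ) (hS : κ.state? = some S) :
    ∃ Q, S.Inv G α Q := by
  cases κ <;> simp only [Config.state?, Option.some.injEq, reduceCtorEq] at hS <;> subst hS <;>
    exact ⟨_, h.1⟩

/-- A step never changes the nodes of budget zero and never adds edges. -/
theorem ConfigInv.keepsSettled {κ κ' : Config V} (h : ConfigInv G α κ) (hs : Step G α κ κ')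
    (hS : κ.state? = some S) (hS' : κ'.state? = some S') :
    S.KeepsSettled S' ∧ S'.edges ⊆ S.edges := by
  cases hs <;> simp only [Config.state?, Option.some.injEq, reduceCtorEq] at hS hS' <;>
    subst hS <;> subst hS'
  case extendNode hx => exact ⟨h.1.extend_keepsSettled hx, subset_rfl⟩
  case evalFree hsel hu hw =>
    obtain ⟨f, -, -, hv, -⟩ := h.1.selects_spec h.2.2 hsel
    refine ⟨keepsSettled_setNode fun g hg => ?_, subset_rfl⟩
    obtain rfl := Option.some.inj (hv.symm.trans hg)
    simp
  case evalCollision hsel hw =>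
    obtain ⟨f, -, -, hv, -⟩ := h.1.selects_spec h.2.2 hsel
    exact ⟨h.1.subtree_removal_keepsSettled hv (by simp) _, Set.sdiff_subset⟩
  case updateNode hq he => exact ⟨h.1.updateChildren_keepsSettled hq he, subset_rfl⟩
  case rewireNode hx _ _ =>
    refine ⟨keepsSettled_setNode fun g hg => ?_, subset_rfl⟩
    rw [h.2.2 _ hx] at hg
    cases hg
  all_goals exact ⟨fun _ _ h _ => h, subset_rfl⟩

theorem Step.exists_state {κ κ' : Config V} (hs : Step G α κ κ') :
    ∃ S, κ.state? = some S := by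
  cases hs <;> exact ⟨_, rfl⟩

theorem ConfigInv.settled_reaches {κ κ' : Config V} (h : ConfigInv G α κ)
    (hr : Reaches G α κ κ') (hS : κ.state? = some S) :
    ∀ {S' : State V}, κ'.state? = some S' → S.KeepsSettled S' := by
  induction hr with
  | refl =>
    intro S' hS'
    obtain rfl := Option.some.inj (hS.symm.trans hS')
    exact fun _ _ h _ => h
  | tail hr hs ih =>
    intro S' hS' x e hx hb
    obtain ⟨T, hT⟩ := hs.exists_state
    exact ((h.reaches hr).keepsSettled hs hT hS').1 x e (ih hT x e hx hb) hb

/-- An execution only gets stuck when it has returned. -/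
theorem ConfigInv.exists_step [Finite V] (hα : 1 ≤ α) {κ : Config V} (h : ConfigInv G α κ)
    (hstuck : ∀ κ', ¬ Step G α κ κ') : (∃ P, κ = .returned P) ∨ κ = .failure := by
  cases κ with
  | extend S => exact absurd (.extendDone fun p e x hx => hstuck _ (.extendNode hx)) (hstuck _)
  | search S =>
    by_cases hfr : ∃ x e, S.InFrontier G α x e
    · obtain ⟨u, v, hsel⟩ := h.1.exists_selects hα h.2.1 hfr
      obtain ⟨f, hf, -⟩ := h.1.selects_spec h.2.2 hsel
      by_cases hw : G.w (u, v) = (G.wHat (u, v) : ℝ≥0∞)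
      · exact absurd (.evalFree hsel hf hw) (hstuck _)
      · exact absurd (.evalCollision hsel hw) (hstuck _)
    · push Not at hfr
      exact absurd (.fail hfr) (hstuck _)
  | foundFree u v S =>
    by_cases hv : v = G.target
    · obtain ⟨c, hc⟩ := h.2.1
      obtain ⟨P, hP⟩ := h.1.exists_treePath hc
      exact absurd (.ret hv hP) (hstuck _)
    · exact absurd (.startUpdate hv) (hstuck _)
  | update Q S =>
    obtain rfl | ⟨q, hq⟩ := Q.eq_empty_or_nonempty
    · exact absurd .updateDone (hstuck _)
    · obtain ⟨e, he⟩ := h.2.2.2 q hq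
      exact absurd (.updateNode hq he) (hstuck _)
  | rewire R S =>
    by_cases hR : ∃ z : V × V, z.2 ∈ R ∧ ∃ e, S.CanParent G α z.1 e z.2
    · obtain ⟨⟨p, x⟩, ⟨hx, e, he⟩, hmin⟩ := Set.exists_min_image
        {z : V × V | z.2 ∈ R ∧ ∃ e, S.CanParent G α z.1 e z.2}
        (fun z => ((S.node z.1).map Entry.key).getD 0 + G.wHat z) (Set.toFinite _) hR
      refine absurd (.rewireNode hx he fun x' hx' p' e' he' => ?_) (hstuck _)
      have := hmin (p', x') ⟨hx', e', he'⟩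
      simpa only [Entry.child_key, he.1, he'.1, Option.map_some, Option.getD_some] using this
    · exact absurd (.rewireDone fun x hx p e he => hR ⟨(p, x), hx, e, he⟩) (hstuck _)
  | returned P => exact Or.inl ⟨P, rfl⟩
  | failure => exact Or.inr rfl

/-! ### Termination -/

/-- The lazy costs of the vertex sequences without repetition: the possible keys. -/
def simpleCosts (G : Problem V) : Set ℝ≥0 := G.lazyCost '' {P | P.Nodup}

theorem finite_simpleCosts [Finite V] (G : Problem V) : (simpleCosts G).Finite := by
  classical
  cases nonempty_fintype V
  have hfin : Finite {P : List V // P.Nodup} := Finite.of_fintype _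
  exact (Set.finite_coe_iff.1 hfin : {P : List V | P.Nodup}.Finite).image _

/-- The number of possible keys below `k`. -/
noncomputable def keyRank (G : Problem V) (k : ℝ≥0) : ℕ := (simpleCosts G ∩ Set.Iio k).ncard

theorem keyRank_lt [Finite V] {k : ℝ≥0} (hk : k ∈ simpleCosts G) :
    keyRank G k < (simpleCosts G).ncard := by
  refine Set.ncard_lt_ncard ⟨Set.inter_subset_left, fun h => ?_⟩ (finite_simpleCosts G)
  exact lt_irrefl k (h hk).2

theorem keyRank_lt_keyRank [Finite V] {k k' : ℝ≥0} (hk : k ∈ simpleCosts G) (hlt : k < k') :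
    keyRank G k < keyRank G k' := by
  refine Set.ncard_lt_ncard ⟨fun a ha => ⟨ha.1, lt_trans ha.2 hlt⟩, fun h => ?_⟩
    ((finite_simpleCosts G).subset Set.inter_subset_left)
  exact lt_irrefl k (h ⟨hk, hlt⟩).2

theorem State.Inv.key_mem_simpleCosts (h : S.Inv G α Q) {x : V} {e : Entry V}
    (hx : S.node x = some e) : e.key ∈ simpleCosts G := by
  obtain ⟨P, hP⟩ := h.exists_treePath hx
  exact ⟨P, h.nodup hP, (h.key_eq_lazyCost hP hx).symm⟩

/-- The weight of a node; a node outweighs `card V` nodes of larger key. -/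
noncomputable def nodeWeight [Fintype V] (G : Problem V) (o : Option (Entry V)) : ℕ :=
  o.elim 0 fun e => (Fintype.card V + 1) ^ ((simpleCosts G).ncard - keyRank G e.key)

/-- The total weight of the search tree. -/
noncomputable def treeWeight [Fintype V] (G : Problem V) (S : State V) : ℕ :=
  ∑ x, nodeWeight G (S.node x)

theorem treeWeight_le [Fintype V] (G : Problem V) (S : State V) :
    treeWeight G S ≤ Fintype.card V * (Fintype.card V + 1) ^ (simpleCosts G).ncard := by
  rw [← smul_eq_mul]
  refine Finset.sum_le_card_nsmul _ _ _ fun x _ => ?_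
  cases S.node x with
  | none => simp [nodeWeight]
  | some e => exact Nat.pow_le_pow_right (by omega) (Nat.sub_le _ _)

/-- Extending a node increases the weight of the tree. -/
theorem treeWeight_lt_extendBy [Fintype V] (h : S.Inv G α ∅) {p x : V} {e : Entry V}
    (hx : S.Extends G α p e x) : treeWeight G S < treeWeight G (S.extendBy G p e x) := by
  classical
  have hmem := (h.extend hx).key_mem_simpleCosts (setNode_self _ x _)
  have hrk := keyRank_lt hmem
  set n := Fintype.card V with hn
  set N := (simpleCosts G).ncard with hN
  set r := keyRank G (Entry.child G p e x).key with hr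
  -- Every removed key is at least the old key of `x`, hence larger than the new one, so its rank
  -- exceeds `r`.
  have hold : ∀ y ∈ S.subtree x, nodeWeight G (S.node y) ≤ (n + 1) ^ (N - r - 1) := by
    intro y hy
    cases hyn : S.node y with
    | none => simp [nodeWeight]
    | some f =>
      obtain ⟨g, hg, -, hgk⟩ := h.le_of_mem_subtree hy hyn
      have := keyRank_lt_keyRank hmem ((hx.2 g hg).trans_le hgk)
      exact Nat.pow_le_pow_right (by omega) (by omega)
  have hnew : nodeWeight G ((S.extendBy G p e x).node x) = (n + 1) * (n + 1) ^ (N - r - 1) := by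
    rw [setNode_self, ← pow_succ']
    change (n + 1) ^ (N - r) = _
    congr 1
    omega
  -- Each vertex is charged the largest weight a removed node can have. The `n` charges together
  -- stay below the weight of the new node, which is `n + 1` of them.
  have hpt : ∀ y, nodeWeight G (S.node y) ≤ (n + 1) ^ (N - r - 1) +
      if y = x then 0 else nodeWeight G ((S.extendBy G p e x).node y) := by
    intro y
    by_cases hy : y ∈ S.subtree x
    · exact (hold y hy).trans (Nat.le_add_right _ _)
    · have hyx : y ≠ x := by
        rintro rfl
        exact hy (mem_subtree_self _ _)
      rw [if_neg hyx, setNode_of_ne _ _ hyx, removeNodes_of_notMem _ hy]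
      exact Nat.le_add_left _ _
  have hsum := Finset.sum_le_sum fun y (_ : y ∈ Finset.univ) => hpt y
  rw [Finset.sum_add_distrib, Finset.sum_const, Finset.card_univ, smul_eq_mul, ← hn] at hsum
  have hsplit : treeWeight G (S.extendBy G p e x) = (n + 1) * (n + 1) ^ (N - r - 1) +
      ∑ y, if y = x then 0 else nodeWeight G ((S.extendBy G p e x).node y) := by
    rw [treeWeight, ← hnew, ← Finset.add_sum_erase _ _ (Finset.mem_univ x),
      ← Finset.add_sum_erase (a := x) _ (fun y => if y = x then 0 else _) (Finset.mem_univ x)]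
    rw [if_pos rfl, zero_add]
    congr 1
    exact Finset.sum_congr rfl fun y hy => (if_neg (Finset.ne_of_mem_erase hy)).symm
  have hpos : 0 < (n + 1) ^ (N - r - 1) := by positivity
  rw [hsplit]
  refine hsum.trans_lt ?_
  gcongr
  omega

/-- The number of edges in the graph, plus the number of vertices that have no node of budget
zero. -/
noncomputable def openCount (S : State V) : ℕ :=
  S.edges.ncard + {x | ∀ e, S.node x = some e → e.b ≠ 0}.ncard

theorem State.KeepsSettled.open_subset (h : S.KeepsSettled S') :
    {x | ∀ e, S'.node x = some e → e.b ≠ 0} ⊆ {x | ∀ e, S.node x = some e → e.b ≠ 0} :=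
  fun x hx e he hb => hx e (h x e he hb) hb

theorem openCount_le [Finite V] (h : S.KeepsSettled S') (hE : S'.edges ⊆ S.edges) :
    openCount S' ≤ openCount S :=
  add_le_add (Set.ncard_le_ncard hE (Set.toFinite _))
    (Set.ncard_le_ncard h.open_subset (Set.toFinite _))

/-- What decreases in every step: first the number of open edges and vertices, then the phase, and
then the amount of work that remains in the phase. -/
noncomputable def rank [Fintype V] (G : Problem V) : Config V → ℕ ×ₗ ℕ ×ₗ ℕ
  -- The added 1 leaves 0 for the final configurations. Phases fall from 3 or 2 through 1 to 0
  -- between evaluations; an evaluation raises the phase but lowers `openCount`.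
  | .extend S => toLex (openCount S + 1, toLex (1,
      Fintype.card V * (Fintype.card V + 1) ^ (simpleCosts G).ncard - treeWeight G S))
  | .search S => toLex (openCount S + 1, toLex (0, 0))
  | .foundFree _ _ S => toLex (openCount S + 1, toLex (3, 0))
  | .update Q S => toLex (openCount S + 1, toLex (2, {x | S.Pending Q x}.ncard))
  | .rewire R S => toLex (openCount S + 1, toLex (2, R.ncard))
  | .returned _ => toLex (0, toLex (0, 0))
  | .failure => toLex (0, toLex (0, 0))

theorem lex_lt {a b c a' b' c' : ℕ} (ha : a ≤ a') (h : a < a' ∨ b < b' ∨ b = b' ∧ c < c') :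
    toLex (a, toLex (b, c)) < toLex (a', toLex (b', c')) := by
  simp only [Prod.Lex.toLex_lt_toLex]
  omega

theorem rank_lt [Fintype V] {κ κ' : Config V} (h : ConfigInv G α κ) (hs : Step G α κ κ') :
    rank G κ' < rank G κ := by
  have hle : ∀ S S' : State V, κ.state? = some S → κ'.state? = some S' →
      openCount S' + 1 ≤ openCount S + 1 := fun S S' hS hS' => by
    obtain ⟨h1, h2⟩ := h.keepsSettled hs hS hS'
    exact Nat.succ_le_succ (openCount_le h1 h2)
  cases hs with
  | extendNode hx =>
    refine lex_lt (hle _ _ rfl rfl) (Or.inr (Or.inr ⟨rfl, ?_⟩))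
    have h1 := treeWeight_lt_extendBy h.1 hx
    have h2 := treeWeight_le G (S := State.extendBy G _ _ _ _) |>.trans' h1
    exact Nat.sub_lt_sub_left h2 h1
  | extendDone => exact lex_lt (hle _ _ rfl rfl) (by omega)
  | fail => exact lex_lt (Nat.zero_le _) (by omega)
  | @evalFree S u v e hsel hu hw =>
    refine lex_lt (hle _ _ rfl rfl) (Or.inl (Nat.succ_lt_succ ?_))
    obtain ⟨f, -, -, hv, -⟩ := h.1.selects_spec h.2.2 hsel
    have hk := (h.keepsSettled (.evalFree hsel hu hw) rfl rfl).1
    refine add_lt_add_of_le_of_lt le_rfl (Set.ncard_lt_ncard ⟨hk.open_subset, fun hsub => ?_⟩)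
    refine hsub (a := v) (fun g hg => ?_) _ (setNode_self _ _ _) rfl
    obtain rfl := Option.some.inj (hv.symm.trans hg)
    simp
  | @evalCollision S u v hsel hw =>
    refine lex_lt (hle _ _ rfl rfl) (Or.inl (Nat.succ_lt_succ ?_))
    obtain ⟨f, -, -, hv, -⟩ := h.1.selects_spec h.2.2 hsel
    -- The evaluated edge is a tree edge, so it is still in the graph and its deletion counts.
    obtain ⟨-, -, hE, -⟩ := h.1.fits_of_parent hv rfl
    have hk := (h.keepsSettled (.evalCollision hsel hw) rfl rfl).1
    refine add_lt_add_of_lt_of_le ?_ (Set.ncard_le_ncard hk.open_subset)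
    exact Set.ncard_sdiff_singleton_lt_of_mem hE
  | ret => exact lex_lt (Nat.zero_le _) (by omega)
  | startUpdate => exact lex_lt (hle _ _ rfl rfl) (by omega)
  | @updateNode S Q q e hq he =>
    refine lex_lt (hle _ _ rfl rfl) (Or.inr (Or.inr ⟨rfl, ?_⟩))
    rw [Pending.congr (isParent_updateChildren G S q e)]
    refine Set.ncard_lt_ncard ⟨fun x hx => pending_of_children_pending hq hx, fun hsub => ?_⟩
    exact h.1.not_pending_children h.2.2.1 hq (hsub ⟨q, hq, mem_subtree_self _ _⟩)
  | updateDone => exact lex_lt (hle _ _ rfl rfl) (by omega)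
  | rewireNode hx =>
    exact lex_lt (hle _ _ rfl rfl) (Or.inr (Or.inr ⟨rfl, Set.ncard_sdiff_singleton_lt_of_mem hx⟩))
  | rewireDone => exact lex_lt (hle _ _ rfl rfl) (by omega)

/-- There is no infinite execution. -/
theorem no_infinite_run [Finite V] (G : Problem V) (hst : G.source ≠ G.target) (α : ℕ∞) :
    ¬ ∃ run : ℕ → Config V, run 0 = start G ∧ ∀ n, Step G α (run n) (run (n + 1)) := by
  cases nonempty_fintype V
  rintro ⟨run, h0, hrun⟩
  have hinv : ∀ n, ConfigInv G α (run n) := by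
    intro n
    induction n with
    | zero => exact h0 ▸ configInv_start G hst α
    | succ n ih => exact ih.step (hrun n)
  obtain ⟨n, hn⟩ := WellFounded.not_rel_apply_succ (r := (· < ·)) fun n => rank G (run n)
  exact hn (rank_lt (hinv n) (hrun n))

end LRAStar

theorem mainTheorem2 {V : Type*} [Finite V] (G : LRAStar.Problem V)
    (hst : G.source ≠ G.target) (α : ℕ∞) (hα : 1 ≤ α) :
    -- an edge `(v₀, v)` evaluated and found collision-free: from then on, the shortest path to `v`
    -- has been found and the stored cost-to-come is `w*(v)`
    (∀ (v₀ v : V) (S : LRAStar.State V),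
      LRAStar.Reaches G α (LRAStar.start G) (.foundFree v₀ v S) →
      ∀ (κ : LRAStar.Config V) (S' : LRAStar.State V),
        LRAStar.Reaches G α (.foundFree v₀ v S) κ → κ.state? = some S' →
        ∃ (c : NNReal) (P : List V), S'.node v = some ⟨some v₀, c, 0, 0⟩ ∧
          (c : ENNReal) = G.wStar v ∧ S'.TreePath v P ∧ G.IsShortestFreePath v P ∧
          G.cost P = G.wStar v) ∧
    -- every execution terminates
    (¬ ∃ run : ℕ → LRAStar.Config V,
      run 0 = LRAStar.start G ∧ ∀ n, LRAStar.Step G α (run n) (run (n + 1))) ∧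
    -- an execution can only end by returning a path or failure
    (∀ κ : LRAStar.Config V, LRAStar.Reaches G α (LRAStar.start G) κ →
      (∀ κ', ¬ LRAStar.Step G α κ κ') → (∃ P, κ = .returned P) ∨ κ = .failure) ∧
    -- a returned path is a shortest collision-free path to the target
    (∀ P : List V, LRAStar.Reaches G α (LRAStar.start G) (.returned P) →
      G.IsShortestFreePath G.target P ∧ G.cost P = G.wStar G.target) ∧
    -- failure is returned only if there is no collision-free path to the target
    (LRAStar.Reaches G α (LRAStar.start G) .failure →
      ¬ ∃ P, G.IsPathTo G.target P ∧ G.CollisionFree P) := by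
  have hstart := LRAStar.configInv_start G hst α
  refine ⟨fun v₀ v S hr κ S' hr' hS' => ?_, LRAStar.no_infinite_run G hst α,
    fun κ hr hstuck => (hstart.reaches hr).exists_step hα hstuck,
    fun P hr => hstart.reaches hr, fun hr => hstart.reaches hr⟩
  have hfound := hstart.reaches hr
  obtain ⟨c, hc⟩ := hfound.2.1
  -- The later configuration may lie in the middle of an update, so `Q` is arbitrary. The entry of
  -- `v` persists, and optimality is read off from the invariant of the later state.
  obtain ⟨Q, hI⟩ := (hfound.reaches hr').inv hS'
  have hv := hfound.settled_reaches hr' rfl hS' v _ hc rfl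
  obtain ⟨P, hP⟩ := hI.exists_treePath hv
  obtain ⟨hshort, hcost, hstar⟩ := hI.isShortestFreePath hv rfl hP
  exact ⟨c, P, hv, hstar, hP, hshort, hcost⟩
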